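/- Let $\mathcal T$ be a triangulated category. An object $t\in\mathcal T$ is \emph{compact} if $\mathcal T(t,-):\mathcal T\to \mathrm{Ab}$ sends coproducts to coproducts of abelian groups; $\mathcal T$ is \emph{compactly generated} if it has all small coproducts and there is a set $\mathcal G$ of compact objects such that $\mathcal T(g,t)=0$ for all $g\in\mathcal G$ implies $t=0$. A \emph{tensor-triangulated category} is a triangulated category with a closed symmetric monoidal structure $(\otimes,\mathbb 1)$, with internal hom $\underline{\hom}$, whose tensor product is exact in each variable. An object $x$ is \emph{rigid} if the natural map $\underline{\hom}(x,\mathbb 1)\otimes y\to\underline{\hom}(x,y)$ is an isomorphism for every $y$. A tensor-triangulated category is \emph{rigidly-compactly generated} if it is compactly generated and its compact objects are exactly its rigid objects. \textbf{Theorem.} Let $\mathcal C$ and $\mathcal D$ be rigidly-compactly generated tensor-triangulated categories and let $f^*:\mathcal D\to\mathcal C$ be a strong symmetric monoidal triangulated functor which preserves small coproducts. Then: (1) $f^*$ preserves compact objects. (2) $f^*$ has a right adjoint $f_*:\mathcal C\to\mathcal D$, and $f_*$ has a right adjoint $f^{(1)}:\mathcal D\to\mathcal C$. (3) For any such adjoints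 $f^*\dashv f_*\dashv f^{(1)}$, the canonical map $$\pi_{x,y}: x\otimes f_*(y)\longrightarrow f_*(f^*(x)\otimes y)\qquad (x\in\mathcal D,\ y\in\mathcal C),$$ adjoint to $f^*(x\otimes f_*(y))\cong f^*(x)\otimes f^*f_*(y)\to f^*(x)\otimes y$, is an isomorphism, natural in $x$ and $y$. (4) There are canonical isomorphisms, natural in both variables, $$\underline{\hom}_{\mathcal D}(x,f_*y)\cong f_*\,\underline{\hom}_{\mathcal C}(f^*x,y)\qquad (x\in\mathcal D,\ y\in\mathcal C),$$ $$\underline{\hom}_{\mathcal D}(f_*x,y)\cong f_*\,\underline{\hom}_{\mathcal C}(x,f^{(1)}y)\qquad (x\in\mathcal C,\ y\in\mathcal D),$$ $$f^{(1)}\,\underline{\hom}_{\mathcal D}(x,y)\cong \underline{\hom}_{\mathcal C}(f^*x,f^{(1)}y)\qquad (x,y\in\mathcal D).$$ For each fixed $x$, these are obtained by passing to right adjoints from, respectively, the isomorphism $f^*(x)\otimes f^*(-)\cong f^*(x\otimes -)$ of the monoidal structure of $f^*$; the isomorphism $f_*(x)\otimes(-)\cong f_*(x\otimes f^*(-))$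 given by $\pi_{-,x}$ and the symmetries; and the isomorphism $\pi_{x,-}: x\otimes f_*(-)\cong f_*(f^*(x)\otimes -)$. -/

import Mathlib

open CategoryTheory Limits MonoidalCategory Opposite

universe v u u₁ u₂

namespace RigidTT

/-! ### Compactly generated categories -/

section Compact

variable {T : Type u} [Category.{v} T] [Preadditive T]

/-- An object `t` is compact if `Hom(t, -)`, with values in abelian groups, preserves all small
coproducts. -/
def IsCompactObject (t : T) : Prop :=
  ∀ J : Type v, PreservesColimitsOfShape (Discrete J) (preadditiveCoyoneda.obj (op t))

variable (T) in
/-- `T` has all small coproducts, and there is a small set of compact objects which detects the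
vanishing of objects. -/
class IsCompactlyGenerated : Prop where
  hasCoproducts : HasCoproducts.{v} T
  exists_generators : ∃ G : Set T, Small.{v} G ∧ (∀ g ∈ G, IsCompactObject g) ∧
    ∀ t : T, (∀ g ∈ G, ∀ φ : g ⟶ t, φ = 0) → IsZero t

end Compact

/-! ### Rigid objects in a closed monoidal category -/

section Rigid

variable {C : Type u} [Category.{v} C] [MonoidalCategory C] [MonoidalClosed C]

/-- The natural map `hom(x, 𝟙) ⊗ y ⟶ hom(x, y)`: the transpose of
`x ⊗ (hom(x, 𝟙) ⊗ y) ≅ (x ⊗ hom(x, 𝟙)) ⊗ y ⟶ 𝟙 ⊗ y ≅ y`. -/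
noncomputable def dualTensorMap (x y : C) :
    (ihom x).obj (𝟙_ C) ⊗ y ⟶ (ihom x).obj y :=
  MonoidalClosed.curry
    ((α_ x ((ihom x).obj (𝟙_ C)) y).inv ≫ (ihom.ev x).app (𝟙_ C) ▷ y ≫ (λ_ y).hom)

/-- `x` is rigid (strongly dualizable) if `hom(x, 𝟙) ⊗ y ⟶ hom(x, y)` is invertible for all `y`. -/
def IsRigidObject (x : C) : Prop :=
  ∀ y : C, IsIso (dualTensorMap x y)

end Rigid

/-! ### Rigidly-compactly generated tensor triangulated categories -/

section TensorTriangulated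

variable (C : Type u) [Category.{v} C] [HasZeroObject C] [Preadditive C] [HasShift C ℤ]
  [∀ n : ℤ, (shiftFunctor C n).Additive] [Pretriangulated C]
  [MonoidalCategory C] [SymmetricCategory C]

/-- The tensor product is exact in each variable: `x ⊗ -` commutes with the shift and preserves
distinguished triangles (for `- ⊗ x` this follows through the symmetry). No coherence between
the shift isomorphisms for different `x` is imposed, so this covers every usual notion of
compatibility between a symmetric monoidal structure and a triangulation. -/
class IsTensorTriangulated : Prop where
  exact_tensorLeft : ∀ x : C,
    ∃ _ : (tensorLeft x).CommShift ℤ, (tensorLeft x).IsTriangulated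

/-- A closed tensor triangulated category is rigidly-compactly generated if it is compactly
generated and its compact objects are exactly its rigid objects. -/
class IsRigidlyCompactlyGenerated [MonoidalClosed C] : Prop extends
    IsTensorTriangulated C, IsCompactlyGenerated C where
  compact_iff_rigid : ∀ x : C, IsCompactObject x ↔ IsRigidObject x

end TensorTriangulated

/-! ### The canonical comparison maps for `F ⊣ R ⊣ S`

Here `F = f^*`, `R = f_*` and `S = f^{(1)}`. -/

section Comparison

variable {D : Type u₁} [Category.{v} D] [MonoidalCategory D]
  {C : Type u₂} [Category.{v} C] [MonoidalCategory C]
  {F : D ⥤ C} [F.Monoidal] {R : C ⥤ D} {S : D ⥤ C}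

open Functor.OplaxMonoidal in
/-- The map `x ⊗ R y ⟶ R (F x ⊗ y)` corresponding under `F ⊣ R` to
`F (x ⊗ R y) ≅ F x ⊗ F (R y) ⟶ F x ⊗ y`. -/
def projMap (adj : F ⊣ R) (x : D) (y : C) : x ⊗ R.obj y ⟶ R.obj (F.obj x ⊗ y) :=
  adj.homEquiv _ _ (δ F x (R.obj y) ≫ F.obj x ◁ adj.counit.app y)

open Functor.OplaxMonoidal in
lemma projMap_natural_right (adj : F ⊣ R) (x : D) {y y' : C} (g : y ⟶ y') :
    x ◁ R.map g ≫ projMap adj x y' = projMap adj x y ≫ R.map (F.obj x ◁ g) := by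
  unfold projMap
  rw [← adj.homEquiv_naturality_left, ← adj.homEquiv_naturality_right]
  congr 1
  rw [← Category.assoc, ← δ_natural_right, Category.assoc, Category.assoc,
    ← MonoidalCategory.whiskerLeft_comp, ← MonoidalCategory.whiskerLeft_comp,
    adj.counit_naturality]

open Functor.OplaxMonoidal in
lemma projMap_natural_left (adj : F ⊣ R) {x x' : D} (h : x ⟶ x') (y : C) :
    h ▷ R.obj y ≫ projMap adj x' y = projMap adj x y ≫ R.map (F.map h ▷ y) := by
  unfold projMap
  rw [← adj.homEquiv_naturality_left, ← adj.homEquiv_naturality_right]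
  congr 1
  rw [← Category.assoc, ← δ_natural_left, Category.assoc, Category.assoc, whisker_exchange]

/-- `projMap` for fixed `x`, as a natural transformation `x ⊗ R(-) ⟶ R (F x ⊗ -)`. -/
def projFixLeft (adj : F ⊣ R) (x : D) : R ⋙ tensorLeft x ⟶ tensorLeft (F.obj x) ⋙ R where
  app y := projMap adj x y
  naturality _ _ g := projMap_natural_right adj x g

variable [SymmetricCategory D] [SymmetricCategory C]

/-- `projMap` for fixed `y`, as a natural transformation in `x`, with the tensor factors written in
the order `R y ⊗ x ⟶ R (y ⊗ F x)` by means of the symmetries. -/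
def projFixRight (adj : F ⊣ R) (y : C) : tensorLeft (R.obj y) ⟶ F ⋙ tensorLeft y ⋙ R where
  app x := (β_ (R.obj y) x).hom ≫ projMap adj x y ≫ R.map (β_ (F.obj x) y).hom
  naturality x x' h := by
    dsimp
    rw [BraidedCategory.braiding_naturality_right_assoc, ← Category.assoc (h ▷ _),
      projMap_natural_left]
    simp only [Category.assoc, ← R.map_comp, BraidedCategory.braiding_naturality_left]

variable [MonoidalClosed D] [MonoidalClosed C]

/-- For fixed `x`, the natural transformation `hom(x, R(-)) ⟶ R hom(F x, -)` conjugate to the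
monoidal structure isomorphism `F x ⊗ F(-) ⟶ F (x ⊗ -)`. -/
def ihomRightAdjMap (adj : F ⊣ R) (x : D) : R ⋙ ihom x ⟶ ihom (F.obj x) ⋙ R :=
  conjugateEquiv ((ihom.adjunction x).comp adj) (adj.comp (ihom.adjunction (F.obj x)))
    (Functor.Monoidal.commTensorLeft F x).hom

/-- For fixed `x : C`, the natural transformation `R hom(x, S(-)) ⟶ hom(R x, -)` conjugate to the
projection map `R x ⊗ - ⟶ R (x ⊗ F(-))`. -/
def ihomLeftAdjMap (adj : F ⊣ R) (adj' : R ⊣ S) (x : C) :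
    S ⋙ ihom x ⋙ R ⟶ ihom (R.obj x) :=
  conjugateEquiv (adj.comp ((ihom.adjunction x).comp adj')) (ihom.adjunction (R.obj x))
    (projFixRight adj x)

/-- For fixed `x : D`, the natural transformation `hom(F x, S(-)) ⟶ S hom(x, -)` conjugate to the
projection map `x ⊗ R(-) ⟶ R (F x ⊗ -)`. -/
def coprojMap (adj : F ⊣ R) (adj' : R ⊣ S) (x : D) :
    S ⋙ ihom (F.obj x) ⟶ ihom x ⋙ S :=
  conjugateEquiv ((ihom.adjunction (F.obj x)).comp adj') (adj'.comp (ihom.adjunction x))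
    (projFixLeft adj x)

end Comparison

end RigidTT

set_option linter.unusedSectionVars false

/-! Duality gives the first claim: a monoidal functor carries dual pairs to dual pairs, and compact
means rigid on both sides.

The adjoints come from Brown representability. To represent Hom(`F` -, c), start with a coproduct
indexed by all maps from generators, then repeatedly kill the kernel on generators by taking cones.
Maps from a compact object into the homotopy colimit factor through a finite stage, so the limit is
correct on generators (`exists_universal_on_generators`), and then on all objects
(`exists_representation`). The right adjoint `R` is again triangulated, and it preserves coproducts
because `F` preserves compact objects (`preservesCoproducts_rightAdjoint`); hence `R` has a right
adjoint `S` by the same argument.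

For the projection formula, fix y. Both sides are triangulated and preserve coproducts in x, so the
x at all of whose shifts the map is invertible form a localizing class. It contains the generators:
these are rigid, and for dualizable x both sides represent the same functor
(`isIso_projMap_of_exactPairing`). The internal hom formulas are conjugates of isomorphisms between
left adjoints, and inherit invertibility and naturality from them. -/

namespace RigidTT

/-! ### Compact objects -/

section Compactness

variable {T : Type u} [Category.{v} T] [Preadditive T]

/-- A map from a compact object to a coproduct is a finite sum of maps to the summands. -/
lemma IsCompactObject.exists_eq_sum {g : T} (hg : IsCompactObject g) {J : Type v} {X : J → T}
    {c : Cofan X} (hc : IsColimit c) (a : g ⟶ c.pt) :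
    ∃ (s : Finset J) (b : ∀ j, g ⟶ X j), a = ∑ j ∈ s, b j ≫ c.inj j := by
  classical
  have := hg J
  have hc' := isColimitOfPreserves (preadditiveCoyoneda.obj (op g)) hc
  let H : AddSubgroup (g ⟶ c.pt) :=
    { carrier := {a | ∃ (s : Finset J) (b : ∀ j, g ⟶ X j), a = ∑ j ∈ s, b j ≫ c.inj j}
      zero_mem' := ⟨∅, fun _ => 0, by simp⟩
      add_mem' := by
        rintro _ _ ⟨s, b, rfl⟩ ⟨t, d, rfl⟩
        refine ⟨s ∪ t, fun j => (if j ∈ s then b j else 0) + (if j ∈ t then d j else 0), ?_⟩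
        simp only [Preadditive.add_comp, Finset.sum_add_distrib, ite_comp, zero_comp]
        rw [Finset.sum_ite_mem, Finset.sum_ite_mem]
        congr 2 <;> simp
      neg_mem' := by
        rintro _ ⟨s, b, rfl⟩
        exact ⟨s, fun j => - b j, by simp⟩ }
  -- The quotient map by `H` vanishes on maps through a single summand. Those summands have Hom(g,
  -- c.pt) as their coproduct, so the quotient map is zero and `H` is everything.
  have key : AddCommGrpCat.ofHom (QuotientAddGroup.mk' H) =
      (0 : (preadditiveCoyoneda.obj (op g)).obj c.pt ⟶ AddCommGrpCat.of (_ ⧸ H)) := by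
    refine hc'.hom_ext fun ⟨j⟩ => ?_
    ext (b : g ⟶ X j)
    refine (QuotientAddGroup.eq_zero_iff _).2 ⟨{j},
      fun k => if h : j = k then b ≫ eqToHom (by rw [h]) else 0, ?_⟩
    simp
    rfl
  have : QuotientAddGroup.mk' H a = 0 := ConcreteCategory.congr_hom key a
  exact (QuotientAddGroup.eq_zero_iff _).1 this

/-- The bijection `Hom(L g, y) ≃ Hom(g, R y)` of an adjunction between additive functors, as an
isomorphism of functors of `y` with values in abelian groups. -/
def preadditiveCoyonedaCompIso {T' : Type u₁} [Category.{v} T'] [Preadditive T']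
    {L : T ⥤ T'} {R : T' ⥤ T} [R.Additive] (adj : L ⊣ R) (g : T) :
    R ⋙ preadditiveCoyoneda.obj (op g) ≅ preadditiveCoyoneda.obj (op (L.obj g)) :=
  NatIso.ofComponents (fun y => AddEquiv.toAddCommGrpIso
    (X := AddCommGrpCat.of (g ⟶ R.obj y)) (Y := AddCommGrpCat.of (L.obj g ⟶ y))
    (AddEquiv.mk' (adj.homEquiv g y).symm (fun a b => by
      have := adj.left_adjoint_additive
      simp [Adjunction.homEquiv_counit])))
    (fun {y y'} f => by
      ext (a : g ⟶ R.obj y)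
      exact adj.homEquiv_naturality_right_symm a f)

lemma IsCompactObject.map_of_preserves {T' : Type u₁} [Category.{v} T'] [Preadditive T']
    {L : T ⥤ T'} {R : T' ⥤ T} [R.Additive] (adj : L ⊣ R)
    (hR : ∀ J : Type v, PreservesColimitsOfShape (Discrete J) R) {g : T} (hg : IsCompactObject g) :
    IsCompactObject (L.obj g) := fun J =>
  have := hg J
  have := hR J
  preservesColimitsOfShape_of_natIso (preadditiveCoyonedaCompIso adj g)

lemma IsCompactObject.shift [HasShift T ℤ] [∀ n : ℤ, (shiftFunctor T n).Additive] {g : T}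
    (hg : IsCompactObject g) (n : ℤ) : IsCompactObject (g⟦n⟧) :=
  IsCompactObject.map_of_preserves (L := shiftFunctor T n) (R := shiftFunctor T (-n))
    (shiftEquiv T n).toAdjunction (fun _ => inferInstance) hg

end Compactness

/-! ### Maps out of the image of a coproduct -/

section Preserves

variable {D : Type u₁} [Category.{v} D] {C : Type u₂} [Category.{v} C] (F : D ⥤ C)
  {J : Type v} (X : J → D) [HasCoproduct X] [PreservesColimit (Discrete.functor X) F] {c : C}

lemma exists_desc_map_sigma (f : ∀ j, F.obj (X j) ⟶ c) :
    ∃ f' : F.obj (∐ X) ⟶ c, ∀ j, F.map (Sigma.ι X j) ≫ f' = f j :=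
  ⟨(isColimitOfHasCoproductOfPreservesColimit F X).desc (Cofan.mk c f),
    fun j => (isColimitOfHasCoproductOfPreservesColimit F X).fac (Cofan.mk c f) ⟨j⟩⟩

variable {X} in
include F in
lemma map_sigma_hom_ext {f f' : F.obj (∐ X) ⟶ c}
    (h : ∀ j, F.map (Sigma.ι X j) ≫ f = F.map (Sigma.ι X j) ≫ f') : f = f' :=
  (isColimitOfHasCoproductOfPreservesColimit F X).hom_ext fun ⟨j⟩ => h j

end Preserves

/-! ### Cones, generators and homotopy colimits -/

section Brown

open Pretriangulated

variable {D : Type u₁} [Category.{v} D] [HasZeroObject D] [Preadditive D] [HasShift D ℤ]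
    [∀ n : ℤ, (shiftFunctor D n).Additive] [Pretriangulated D]

section Triangle

variable {X Y Z : D} {f : X ⟶ Y} {p : Y ⟶ Z} {d : Z ⟶ X⟦(1 : ℤ)⟧}

lemma mor₁_comp_mor₂_of_mem (hT : Triangle.mk f p d ∈ distTriang D) : f ≫ p = 0 :=
  comp_distTriang_mor_zero₁₂ _ hT

lemma mor₃_comp_shift_mor₁_of_mem (hT : Triangle.mk f p d ∈ distTriang D) : d ≫ f⟦(1 : ℤ)⟧' = 0 :=
  comp_distTriang_mor_zero₃₁ _ hT

lemma exists_comp_mor₂_of_mem (hT : Triangle.mk f p d ∈ distTriang D) {A : D} (a : A ⟶ Z)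
    (ha : a ≫ d = 0) : ∃ b : A ⟶ Y, a = b ≫ p :=
  Triangle.coyoneda_exact₃ _ hT a ha

/-- A cone is a weak cokernel, also after applying `F`. This is the exactness of Hom(`F` -, c),
which extends maps to `c` over newly attached cells. -/
lemma exists_map_mor₂_comp_of_mem (hT : Triangle.mk f p d ∈ distTriang D)
    {C : Type u₂} [Category.{v} C] [HasZeroObject C] [Preadditive C] [HasShift C ℤ]
    [∀ n : ℤ, (shiftFunctor C n).Additive] [Pretriangulated C] (F : D ⥤ C) [F.CommShift ℤ]
    [F.IsTriangulated] {c : C} (k : F.obj Y ⟶ c) (hk : F.map f ≫ k = 0) :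
    ∃ k' : F.obj Z ⟶ c, F.map p ≫ k' = k :=
  (Triangle.yoneda_exact₂ _ (F.map_distinguished _ hT) k hk).imp fun _ h => h.symm

end Triangle

/-- A property of objects which is stable under isomorphisms, small coproducts and cones. -/
structure IsLocalizing (P : ObjectProperty D) : Prop where
  of_iso : ∀ {X Y : D}, (X ≅ Y) → P X → P Y
  sigma : ∀ {J : Type v} (X : J → D) [HasCoproduct X], (∀ j, P (X j)) → P (∐ X)
  cone : ∀ T ∈ distTriang D, P T.obj₁ → P T.obj₂ → P T.obj₃

/-- A set of compact objects which is stable under shifts and detects the vanishing of objects. -/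
structure IsCompactGeneratingSet (G : Set D) : Prop where
  compact : ∀ g ∈ G, IsCompactObject g
  shift : ∀ g ∈ G, ∀ n : ℤ, ∃ g' ∈ G, Nonempty (g⟦n⟧ ≅ g')
  isZero : ∀ t : D, (∀ g ∈ G, ∀ φ : g ⟶ t, φ = 0) → IsZero t

/-- Shifts of compact objects are compact, so the given generators can be closed under shifts. -/
lemma exists_isCompactGeneratingSet [IsCompactlyGenerated D] :
    ∃ G : Set D, Small.{v} G ∧ IsCompactGeneratingSet G := by
  obtain ⟨G, hs, hc, hz⟩ := IsCompactlyGenerated.exists_generators (T := D)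
  refine ⟨Set.range fun p : G × ℤ => p.1.1⟦p.2⟧, inferInstance, ⟨?_, ?_, ?_⟩⟩
  · rintro _ ⟨⟨g, n⟩, rfl⟩
    exact (hc g g.2).shift n
  · rintro _ ⟨⟨g, n⟩, rfl⟩ m
    exact ⟨_, ⟨⟨g, n + m⟩, rfl⟩, ⟨(shiftFunctorAdd D n m).symm.app g.1⟩⟩
  · refine fun t ht => hz t fun g hg φ => ?_
    have := ht _ ⟨⟨⟨g, hg⟩, 0⟩, rfl⟩ ((shiftFunctorZero D ℤ).hom.app g ≫ φ)
    rwa [← cancel_epi ((shiftFunctorZero D ℤ).hom.app g), comp_zero]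

variable {G : Set D} (hG : IsCompactGeneratingSet G)

include hG in
/-- A morphism is invertible if it induces bijections on maps from the generators. -/
lemma IsCompactGeneratingSet.isIso {X Y : D} (f : X ⟶ Y)
    (h : ∀ g ∈ G, Function.Bijective fun a : g ⟶ X => a ≫ f) : IsIso f := by
  obtain ⟨Z, p, d, hT⟩ := distinguished_cocone_triangle f
  have hZ : IsZero Z := hG.isZero Z fun g hg φ => by
    -- The transpose of `φ ≫ d` is a map from `g⟦-1⟧` to `X` killed by `f`; injectivity on the
    -- shifted generator applies.
    have hd : φ ≫ d = 0 := by
      obtain ⟨g', hg', ⟨e⟩⟩ := hG.shift g hg (-1)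
      have hinj : ∀ b : g⟦(-1 : ℤ)⟧ ⟶ X, b ≫ f = 0 → b = 0 := fun b hb => by
        have : e.inv ≫ b = 0 := (h g' hg').1 (by simp [hb])
        rwa [← cancel_epi e.inv, comp_zero]
      let adj : shiftFunctor D (-1 : ℤ) ⊣ shiftFunctor D (1 : ℤ) :=
        (shiftEquiv' D (-1 : ℤ) 1 (by simp)).toAdjunction
      apply (adj.homEquiv g X).symm.injective
      rw [Adjunction.homAddEquiv_symm_zero]
      apply hinj
      rw [← adj.homEquiv_naturality_right_symm]
      have : (φ ≫ d) ≫ f⟦(1 : ℤ)⟧' = 0 := by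
        rw [Category.assoc, mor₃_comp_shift_mor₁_of_mem hT, comp_zero]
      rw [this, Adjunction.homAddEquiv_symm_zero]
    obtain ⟨b, rfl⟩ := exists_comp_mor₂_of_mem hT φ hd
    obtain ⟨c, rfl⟩ := (h g hg).2 b
    dsimp only
    rw [Category.assoc, mor₁_comp_mor₂_of_mem hT, comp_zero]
  exact (Triangle.isZero₃_iff_isIso₁ _ hT).1 hZ

section Telescope

variable [HasCoproducts.{v} D] {X : ℕ → D} (i : ∀ n, X n ⟶ X (n + 1))

/-- The shift endomorphism of the coproduct of a sequence. -/
noncomputable def telescopeShift : (∐ fun n : ULift.{v} ℕ => X n.down) ⟶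
    ∐ fun n : ULift.{v} ℕ => X n.down :=
  Sigma.desc fun n => i n.down ≫ Sigma.ι (fun n : ULift.{v} ℕ => X n.down) ⟨n.down + 1⟩

lemma ι_telescopeShift (n : ULift.{v} ℕ) :
    Sigma.ι (fun n : ULift.{v} ℕ => X n.down) n ≫ telescopeShift i =
      i n.down ≫ Sigma.ι (fun n : ULift.{v} ℕ => X n.down) ⟨n.down + 1⟩ := by
  simp [telescopeShift]

/-- A map fixed by the telescope shift has n+1-st component determined by the n-th, and zeroth
component 0. So all components vanish, and a map from a compact object is determined by its
components. -/
lemma telescopeShift_injective {g : D} (hg : IsCompactObject g)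
    (d : g ⟶ (∐ fun n : ULift.{v} ℕ => X n.down)⟦(1 : ℤ)⟧)
    (hd : d ≫ (𝟙 _ - telescopeShift i)⟦(1 : ℤ)⟧' = 0) : d = 0 := by
  classical
  let Y : ULift.{v} ℕ → D := fun n => X n.down
  let π (n : ℕ) : (∐ Y) ⟶ X n := Sigma.desc fun m =>
    if h : m.down = n then eqToHom (by rw [← h]) else 0
  have hπ (n : ULift.{v} ℕ) : Sigma.ι Y n ≫ π n.down = 𝟙 _ := by simp [π]
  have hπ' (m : ULift.{v} ℕ) (n : ℕ) (h : m.down ≠ n) : Sigma.ι Y m ≫ π n = 0 := by simp [π, h]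
  have h0 : telescopeShift i ≫ π 0 = 0 := by
    refine Sigma.hom_ext _ _ fun n => ?_
    rw [reassoc_of% ι_telescopeShift i, hπ' _ _ (by simp), comp_zero, comp_zero]
  have h1 (n : ℕ) : telescopeShift i ≫ π (n + 1) = π n ≫ i n := by
    refine Sigma.hom_ext _ _ fun m => ?_
    rw [reassoc_of% ι_telescopeShift i]
    by_cases h : m.down = n
    · subst h
      erw [hπ ⟨m.down + 1⟩]
      rw [reassoc_of% hπ m, Category.comp_id]
    · rw [hπ' _ _ (by simpa using h), reassoc_of% hπ' _ _ h, comp_zero, zero_comp]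
  have hd' : d = d ≫ (telescopeShift i)⟦(1 : ℤ)⟧' := by
    rwa [Functor.map_sub, Preadditive.comp_sub, sub_eq_zero, CategoryTheory.Functor.map_id,
      Category.comp_id] at hd
  have key (n : ℕ) : d ≫ (π n)⟦(1 : ℤ)⟧' = 0 := by
    induction n with
    | zero => rw [hd', Category.assoc, ← Functor.map_comp, h0, Functor.map_zero, comp_zero]
    | succ n ih =>
      rw [hd', Category.assoc, ← Functor.map_comp, h1, Functor.map_comp, reassoc_of% ih, zero_comp]
  obtain ⟨s, b, hb⟩ := hg.exists_eq_sum
    (isColimitOfHasCoproductOfPreservesColimit (shiftFunctor D (1 : ℤ)) Y) d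
  simp only [Cofan.mk_pt, Cofan.inj, Cofan.mk_ι_app] at hb
  rw [hb]
  refine Finset.sum_eq_zero fun n hn => ?_
  have := key n.down
  rw [hb, Preadditive.sum_comp, Finset.sum_eq_single n] at this
  · rw [Category.assoc, ← Functor.map_comp, hπ, CategoryTheory.Functor.map_id,
      Category.comp_id] at this
    rw [this, zero_comp]
  · intro m _ hm
    rw [Category.assoc, ← Functor.map_comp, hπ', Functor.map_zero, comp_zero]
    exact fun h => hm (ULift.down_injective h)
  · exact fun h => (h hn).elim

/-- The homotopy colimit of a sequence, with the properties used for Brown representability. -/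
lemma exists_hocolim {C : Type u₂} [Category.{v} C] [HasZeroObject C] [Preadditive C] [HasShift C ℤ]
    [∀ n : ℤ, (shiftFunctor C n).Additive] [Pretriangulated C] (F : D ⥤ C) [F.CommShift ℤ]
    [F.IsTriangulated] (hF : ∀ J : Type v, PreservesColimitsOfShape (Discrete J) F) {c : C}
    (f : ∀ n, F.obj (X n) ⟶ c) (hf : ∀ n, F.map (i n) ≫ f (n + 1) = f n) :
    ∃ (H : D) (ι : ∀ n, X n ⟶ H) (f' : F.obj H ⟶ c),
      (∀ n, i n ≫ ι (n + 1) = ι n) ∧ (∀ n, F.map (ι n) ≫ f' = f n) ∧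
      (∀ g : D, IsCompactObject g → ∀ a : g ⟶ H, ∃ (n : ℕ) (b : g ⟶ X n), a = b ≫ ι n) ∧
      (∀ P : ObjectProperty D, IsLocalizing P → (∀ n, P (X n)) → P H) := by
  have := hF
  let Y : ULift.{v} ℕ → D := fun n => X n.down
  obtain ⟨H, p, d, hT⟩ := distinguished_cocone_triangle
    (𝟙 (∐ fun n : ULift.{v} ℕ => X n.down) - telescopeShift i)
  have hp : telescopeShift i ≫ p = p := by
    have := mor₁_comp_mor₂_of_mem hT
    rw [Preadditive.sub_comp, sub_eq_zero, Category.id_comp] at this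
    exact this.symm
  let ι (n : ℕ) : X n ⟶ H := Sigma.ι Y ⟨n⟩ ≫ p
  have hι (n : ℕ) : i n ≫ ι (n + 1) = ι n := by
    dsimp [ι]
    conv_rhs => rw [← hp]
    rw [reassoc_of% ι_telescopeShift i]
  obtain ⟨k, hk⟩ := exists_desc_map_sigma F Y (fun n => f n.down)
  -- Compatibility of the `f n` says that `k` does not distinguish the identity from the shift, so
  -- `k` extends over the cone.
  have hk0 : F.map (𝟙 _ - telescopeShift i) ≫ k = 0 := by
    rw [Functor.map_sub, Preadditive.sub_comp, sub_eq_zero, CategoryTheory.Functor.map_id,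
      Category.id_comp]
    refine map_sigma_hom_ext F fun n => ?_
    rw [← F.map_comp_assoc, ι_telescopeShift, F.map_comp_assoc, hk, hk, hf]
  obtain ⟨f', hf'⟩ := exists_map_mor₂_comp_of_mem hT F k hk0
  refine ⟨H, ι, f', hι, fun n => ?_, fun g hg a => ?_, fun P hP h => ?_⟩
  · rw [F.map_comp_assoc, hf', hk]
  · have ha : a ≫ d = 0 := telescopeShift_injective i hg _ (by
      rw [Category.assoc, mor₃_comp_shift_mor₁_of_mem hT, comp_zero])
    obtain ⟨b, hb⟩ := exists_comp_mor₂_of_mem hT a ha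
    obtain ⟨s, b, rfl⟩ := hg.exists_eq_sum (coproductIsCoproduct Y) b
    simp only [Cofan.mk_pt, Cofan.inj, Cofan.mk_ι_app] at hb
    -- A finite sum of maps through various stages is moved to one common stage.
    have mono (m n : ℕ) (h : m ≤ n) (x : g ⟶ X m) : ∃ y : g ⟶ X n, x ≫ ι m = y ≫ ι n := by
      induction n, h using Nat.le_induction with
      | base => exact ⟨x, rfl⟩
      | succ n _ ih =>
        obtain ⟨y, hy⟩ := ih
        exact ⟨y ≫ i n, by rw [hy, Category.assoc, hι]⟩
    have key (s : Finset (ULift.{v} ℕ)) :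
        ∃ (n : ℕ) (y : g ⟶ X n), ∑ j ∈ s, b j ≫ ι j.down = y ≫ ι n := by
      classical
      induction s using Finset.induction_on with
      | empty => exact ⟨0, 0, by simp⟩
      | insert m s hm ih =>
        obtain ⟨n, y, hy⟩ := ih
        obtain ⟨y₁, h₁⟩ := mono _ (max m.down n) (le_max_left _ _) (b m)
        obtain ⟨y₂, h₂⟩ := mono _ (max m.down n) (le_max_right _ _) y
        exact ⟨_, y₁ + y₂, by rw [Finset.sum_insert hm, hy, h₁, h₂, Preadditive.add_comp]⟩
    obtain ⟨n, y, hy⟩ := key s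
    refine ⟨n, y, ?_⟩
    rw [hb, ← hy, Preadditive.sum_comp]
    exact Finset.sum_congr rfl fun j _ => Category.assoc _ _ _
  · exact hP.cone _ hT (hP.sigma _ fun n => h n.down) (hP.sigma _ fun n => h n.down)

end Telescope

end Brown

/-! ### Brown representability and right adjoints -/

section Representability

open Pretriangulated

variable {D : Type u₁} [Category.{v} D] [HasZeroObject D] [Preadditive D] [HasShift D ℤ]
    [∀ n : ℤ, (shiftFunctor D n).Additive] [Pretriangulated D] [HasCoproducts.{v} D]
    {G : Set D} [Small.{v} G]
    {C : Type u₂} [Category.{v} C] [HasZeroObject C] [Preadditive C] [HasShift C ℤ]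
    [∀ n : ℤ, (shiftFunctor C n).Additive] [Pretriangulated C] (F : D ⥤ C) [F.CommShift ℤ]
    [F.IsTriangulated]

variable (G) in
/-- Adding a cell for every map from an object of `G` which is killed by `f`. -/
lemma exists_attach_cells (hF : ∀ J : Type v, PreservesColimitsOfShape (Discrete J) F)
    {c : C} {X : D} (f : F.obj X ⟶ c) :
    ∃ (X' : D) (i : X ⟶ X') (f' : F.obj X' ⟶ c), F.map i ≫ f' = f ∧
      (∀ g ∈ G, ∀ a : g ⟶ X, F.map a ≫ f = 0 → a ≫ i = 0) ∧
      (∀ P : ObjectProperty D, IsLocalizing P → (∀ g ∈ G, P g) → P X → P X') := by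
  have := hF
  let I := Σ g : G, {a : g.1 ⟶ X // F.map a ≫ f = 0}
  let e : I ≃ Shrink.{v} I := equivShrink I
  let K : Shrink.{v} I → D := fun j => (e.symm j).1.1
  let k : (∐ K) ⟶ X := Sigma.desc fun j => (e.symm j).2.1
  obtain ⟨X', i, d, hT⟩ := distinguished_cocone_triangle k
  obtain ⟨f', hf'⟩ := exists_map_mor₂_comp_of_mem hT F f (by
    refine map_sigma_hom_ext F fun j => ?_
    rw [← F.map_comp_assoc, Sigma.ι_desc, comp_zero]
    exact (e.symm j).2.2)
  refine ⟨X', i, f', hf', fun g hg a ha => ?_, fun P hP h h' => ?_⟩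
  · let p : I := ⟨⟨g, hg⟩, ⟨a, ha⟩⟩
    -- Stated for all `q` so that `e.symm (e q)` can be rewritten although the type of the map
    -- depends on it.
    have h : ∀ q : I, q.2.1 ≫ i = 0 := fun q => by
      have : (e.symm (e q)).2.1 ≫ i = 0 := by
        rw [← Sigma.ι_desc (fun j => (e.symm j).2.1) (e q), Category.assoc]
        erw [mor₁_comp_mor₂_of_mem hT]
        rw [comp_zero]
      rwa [e.symm_apply_apply] at this
    exact h p
  · exact hP.cone _ hT (hP.sigma _ fun j => h _ (e.symm j).1.2) h'

/-- Every object over `c` maps to one which represents `Hom(F -, c)` on the generators. -/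
lemma exists_universal_on_generators (hG : IsCompactGeneratingSet G)
    (hF : ∀ J : Type v, PreservesColimitsOfShape (Discrete J) F)
    {c : C} {Y : D} (h : F.obj Y ⟶ c) :
    ∃ (X : D) (j : Y ⟶ X) (f : F.obj X ⟶ c), F.map j ≫ f = h ∧
      (∀ g ∈ G, Function.Bijective fun a : g ⟶ X => F.map a ≫ f) ∧
      (∀ P : ObjectProperty D, IsLocalizing P → (∀ g ∈ G, P g) → P Y → P X) := by
  have := hF
  let I := Σ g : G, (F.obj g.1 ⟶ c)
  let e : I ≃ Shrink.{v} I := equivShrink I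
  -- The summand `none` carries `Y`; the others realize every map from a generator, so surjectivity
  -- on generators already holds at stage 0.
  let K : Option (Shrink.{v} I) → D := fun j => j.elim Y fun j => (e.symm j).1.1
  obtain ⟨f₀, hf₀⟩ := exists_desc_map_sigma F K (c := c) (fun j => match j with
    | none => h
    | some j => (e.symm j).2)
  choose next i f' hi hkill hP using
    fun s : (Σ X : D, (F.obj X ⟶ c)) => exists_attach_cells G F hF s.2
  let s (n : ℕ) : Σ X : D, (F.obj X ⟶ c) :=
    n.rec ⟨∐ K, f₀⟩ (fun _ t => ⟨next t, f' t⟩)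
  obtain ⟨H, ι, f, hι, hf, hc, hPH⟩ := exists_hocolim (fun n => i (s n)) F hF (fun n => (s n).2)
    (fun n => hi (s n))
  have hcomp (j) : F.map (Sigma.ι K j ≫ ι 0) ≫ f = F.map (Sigma.ι K j) ≫ f₀ := by
    rw [F.map_comp_assoc, hf 0]; rfl
  refine ⟨H, Sigma.ι K none ≫ ι 0, f, ?_, fun g hg => ⟨?_, fun b => ?_⟩, fun P hPl hPG hPY => ?_⟩
  · exact (hcomp none).trans (hf₀ none)
  -- A map killed by `f` comes from a finite stage, and the next stage kills it.
  · have key : ∀ a : g ⟶ H, F.map a ≫ f = 0 → a = 0 := fun a ha => by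
      obtain ⟨n, b, rfl⟩ := hc g (hG.compact g hg) a
      rw [F.map_comp_assoc, hf] at ha
      have := hkill (s n) g hg b ha
      rw [← hι, reassoc_of% this, zero_comp]
    intro a b hab
    rw [← sub_eq_zero]
    apply key
    rw [F.map_sub, Preadditive.sub_comp, sub_eq_zero]
    exact hab
  · have key : ∀ q : I, ∃ a : q.1.1 ⟶ H, F.map a ≫ f = q.2 := fun q => by
      have : ∃ a : (e.symm (e q)).1.1 ⟶ H, F.map a ≫ f = (e.symm (e q)).2 := by
        exact ⟨Sigma.ι K (some (e q)) ≫ ι 0, (hcomp _).trans (hf₀ (some (e q)))⟩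
      rwa [e.symm_apply_apply] at this
    exact key ⟨⟨g, hg⟩, b⟩
  · refine hPH P hPl fun n => ?_
    induction n with
    | zero =>
      refine hPl.sigma _ fun j => ?_
      cases j with
      | none => exact hPY
      | some j => exact hPG _ (e.symm j).1.2
    | succ n ih => exact hP _ P hPl hPG ih

/-- A localizing property which holds for the generators holds for all objects. -/
lemma IsLocalizing.of_generators (hG : IsCompactGeneratingSet G) {P : ObjectProperty D}
    (hP : IsLocalizing P) (h : ∀ g ∈ G, P g) (t : D) : P t := by
  -- Starting from the empty coproduct, on which `P` holds automatically, the construction uses only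
  -- generators.
  obtain ⟨X, j, f, -, hf, hX⟩ := exists_universal_on_generators (𝟭 D) hG
    (fun _ => inferInstance) (c := t) (Y := ∐ (PEmpty.elim : PEmpty.{v + 1} → D)) (Sigma.desc nofun)
  have : IsIso (X := X) (Y := t) f := hG.isIso f hf
  exact hP.of_iso (asIso (X := X) (Y := t) f) (hX P hP h (hP.sigma _ nofun))

/-- Brown representability for `Hom(F -, c)`. -/
lemma exists_representation (hG : IsCompactGeneratingSet G)
    (hF : ∀ J : Type v, PreservesColimitsOfShape (Discrete J) F) (c : C) :
    ∃ (X : D) (f : F.obj X ⟶ c), ∀ (Z : D) (b : F.obj Z ⟶ c), ∃! a : Z ⟶ X, F.map a ≫ f = b := by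
  have := hF
  obtain ⟨X, -, f, -, hf, -⟩ := exists_universal_on_generators F hG hF
    (0 : F.obj (∐ (PEmpty.elim : PEmpty.{v + 1} → D)) ⟶ c)
  -- Any map over `c` between two objects that are universal on generators is invertible.
  have isIso {X' : D} (f' : F.obj X' ⟶ c)
      (hf' : ∀ g ∈ G, Function.Bijective fun a : g ⟶ X' => F.map a ≫ f')
      (k : X ⟶ X') (hk : F.map k ≫ f' = f) : IsIso k := hG.isIso k fun g hg => by
    have := hf g hg
    simp only [← hk, ← F.map_comp_assoc] at this
    exact (Function.Bijective.of_comp_iff' (hf' g hg) _).1 this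
  refine ⟨X, f, fun Z b => existsUnique_of_exists_of_unique ?_ ?_⟩
  -- Existence: enlarge `X ⨿ Z` to a universal `X'`; then `X ⟶ X'` is invertible, and `Z ⟶ X'` can
  -- be carried back to `X`.
  · obtain ⟨k₀, hk₀⟩ := exists_desc_map_sigma F (J := ULift.{v} Bool)
      (fun j => match j with | ⟨true⟩ => X | ⟨false⟩ => Z) (c := c)
      (fun j => match j with | ⟨true⟩ => f | ⟨false⟩ => b)
    obtain ⟨X', j, f', hj, hf', -⟩ := exists_universal_on_generators F hG hF k₀
    let ι₁ : X ⟶ X' := Sigma.ι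
      (fun j : ULift.{v} Bool => match j with | ⟨true⟩ => X | ⟨false⟩ => Z) ⟨true⟩ ≫ j
    let ι₂ : Z ⟶ X' := Sigma.ι
      (fun j : ULift.{v} Bool => match j with | ⟨true⟩ => X | ⟨false⟩ => Z) ⟨false⟩ ≫ j
    have h₁ : F.map ι₁ ≫ f' = f := by
      refine Eq.trans ?_ (hk₀ ⟨true⟩)
      rw [← hj, ← F.map_comp_assoc]
    have h₂ : F.map ι₂ ≫ f' = b := by
      refine Eq.trans ?_ (hk₀ ⟨false⟩)
      rw [← hj, ← F.map_comp_assoc]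
    have := isIso f' hf' ι₁ h₁
    refine ⟨ι₂ ≫ inv ι₁, ?_⟩
    rw [← h₂, ← h₁, ← F.map_comp_assoc, Category.assoc, IsIso.inv_hom_id, Category.comp_id]
  · intro a a' ha ha'
    -- Uniqueness: `f` extends over the cone of `a - a'`. Enlarging the cone to a universal object
    -- makes `i ≫ j` invertible, yet it kills `a - a'`.
    obtain ⟨Y, i, d, hT⟩ := distinguished_cocone_triangle (a - a')
    obtain ⟨k, hk⟩ := exists_map_mor₂_comp_of_mem hT F f (by
      rw [F.map_sub, Preadditive.sub_comp, ha, ha', sub_self])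
    obtain ⟨X', j, f', hj, hf', -⟩ := exists_universal_on_generators F hG hF k
    have := isIso f' hf' (i ≫ j) (by rw [F.map_comp_assoc, hj, hk])
    rw [← sub_eq_zero, ← cancel_mono (i ≫ j), reassoc_of% mor₁_comp_mor₂_of_mem hT, zero_comp,
      zero_comp]

/-- A triangulated functor on a compactly generated category which preserves coproducts has a
right adjoint. -/
lemma isLeftAdjoint_of_preservesCoproducts (hG : IsCompactGeneratingSet G)
    (hF : ∀ J : Type v, PreservesColimitsOfShape (Discrete J) F) : F.IsLeftAdjoint := by
  rw [isLeftAdjoint_iff_hasTerminal_costructuredArrow]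
  intro c
  obtain ⟨X, f, hf⟩ := exists_representation F hG hF c
  exact (IsTerminal.ofUniqueHom (Y := CostructuredArrow.mk f)
    (fun Z => CostructuredArrow.homMk (hf _ Z.hom).choose (hf _ Z.hom).choose_spec.1)
    (fun Z m => CostructuredArrow.hom_ext _ _
      ((hf _ Z.hom).choose_spec.2 _ (CostructuredArrow.w m)))).hasTerminal

/-- The right adjoint of a functor which preserves compact objects preserves coproducts. -/
lemma preservesCoproducts_rightAdjoint (hG : IsCompactGeneratingSet G) [HasCoproducts.{v} C]
    {F : D ⥤ C} [F.Additive] {R : C ⥤ D} (adj : F ⊣ R)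
    (hF : ∀ x, IsCompactObject x → IsCompactObject (F.obj x))
    (J : Type v) : PreservesColimitsOfShape (Discrete J) R := by
  classical
  have := adj.right_adjoint_additive
  have hR (X : J → C) : IsIso (sigmaComparison R X) := hG.isIso _ fun g hg => by
    refine ⟨fun a a' h => ?_, fun a => ?_⟩
    · rw [← sub_eq_zero]
      have h' : (a - a') ≫ sigmaComparison R X = 0 := by
        rw [Preadditive.sub_comp, sub_eq_zero]
        exact h
      obtain ⟨s, b, hb⟩ := (hG.compact g hg).exists_eq_sum (coproductIsCoproduct _) (a - a')
      simp only [Cofan.mk_pt, Cofan.inj, Cofan.mk_ι_app] at hb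
      rw [hb] at h' ⊢
      refine Finset.sum_eq_zero fun j hj => ?_
      -- The image under `R` of the projection to the j-th summand reads off `b j`.
      let π : (∐ X) ⟶ X j := Sigma.desc fun i => if h : i = j then eqToHom (by rw [h]) else 0
      have hπ : Sigma.ι X j ≫ π = 𝟙 _ := by simp [π]
      have hπ' (i : J) (h : i ≠ j) : Sigma.ι X i ≫ π = 0 := by simp [π, h]
      have : b j = 0 := by
        have h'' := h' =≫ R.map π
        simp only [Category.assoc, Preadditive.sum_comp, ι_comp_sigmaComparison_assoc,
          ← R.map_comp, zero_comp] at h''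
        rwa [Finset.sum_eq_single j, hπ, R.map_id, Category.comp_id] at h''
        · intro i _ hi
          rw [hπ' i hi, R.map_zero, comp_zero]
        · exact fun h => (h hj).elim
      rw [this, zero_comp]
    -- Surjectivity: `F g` is compact, so the transpose of `a` is a finite sum through the summands.
    · obtain ⟨s, b, hb⟩ := (hF g (hG.compact g hg)).exists_eq_sum (coproductIsCoproduct X)
        ((adj.homEquiv _ _).symm a)
      simp only [Cofan.mk_pt, Cofan.inj, Cofan.mk_ι_app] at hb
      refine ⟨∑ j ∈ s, adj.homEquiv _ _ (b j) ≫ Sigma.ι (fun j => R.obj (X j)) j, ?_⟩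
      apply (adj.homEquiv _ _).symm.injective
      dsimp only
      rw [hb, Preadditive.sum_comp]
      simp only [Category.assoc, ι_comp_sigmaComparison, ← adj.homEquiv_naturality_right]
      exact (map_sum (adj.homAddEquiv _ _).symm _ _).trans
        (Finset.sum_congr rfl fun j _ => (adj.homEquiv _ _).symm_apply_apply _)
  have (X : J → C) : PreservesColimit (Discrete.functor X) R :=
    PreservesCoproduct.of_iso_comparison R X
  exact preservesColimitsOfShape_of_discrete R

end Representability

/-! ### Rigid objects, dual pairs and monoidal functors -/

section Duals

variable {C : Type u} [Category.{v} C] [MonoidalCategory C]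

/-- One triangle identity implies the other after pairing with `e`. -/
lemma triangle_of_triangle {x d : C} (c : 𝟙_ C ⟶ d ⊗ x) (e : x ⊗ d ⟶ 𝟙_ C)
    (h : x ◁ c ≫ (α_ x d x).inv ≫ e ▷ x ≫ (λ_ x).hom = (ρ_ x).hom) :
    x ◁ (c ▷ d ≫ (α_ d x d).hom ≫ d ◁ e) ≫ (α_ x d (𝟙_ C)).inv ≫ e ▷ 𝟙_ C ≫ (λ_ (𝟙_ C)).hom =
      x ◁ ((λ_ d).hom ≫ (ρ_ d).inv) ≫ (α_ x d (𝟙_ C)).inv ≫ e ▷ 𝟙_ C ≫ (λ_ (𝟙_ C)).hom :=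
  calc
    _ = 𝟙 _ ⊗≫ x ◁ c ▷ d ⊗≫ ((x ⊗ d) ◁ e ≫ e ▷ 𝟙_ C) ⊗≫ 𝟙 _ := by monoidal
    -- The two copies of `e` act on disjoint factors; exchanging them exposes the left side of `h`.
    _ = 𝟙 _ ⊗≫ x ◁ c ▷ d ⊗≫ (e ▷ (x ⊗ d) ≫ 𝟙_ C ◁ e) ⊗≫ 𝟙 _ := by rw [whisker_exchange]
    _ = x ◁ (λ_ d).hom ≫ x ◁ (λ_ d).inv ≫ (α_ _ _ _).inv ≫
          (x ◁ c ≫ (α_ x d x).inv ≫ e ▷ x ≫ (λ_ x).hom) ▷ d ≫ e := by monoidal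
    _ = _ := by
      rw [h]
      monoidal

section Closed

variable [MonoidalClosed C]

/-- An exact pairing identifies `d ⊗ y` with the internal hom `hom(x, y)`. -/
lemma isIso_curry_evaluation (d x : C) [ExactPairing d x] (y : C) :
    IsIso (MonoidalClosed.curry ((α_ x d y).inv ≫ ExactPairing.evaluation d x ▷ y ≫ (λ_ y).hom)) := by
  refine isIso_of_yoneda_map_bijective _ fun z => ?_
  -- By Yoneda: Hom(z, d ⊗ y) ≅ Hom(x ⊗ z, y) ≅ Hom(z, hom(x, y)).
  have h := ((ihom.adjunction x).homEquiv z y).bijective.comp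
    (tensorLeftHomEquiv z d x y).symm.bijective
  convert h using 1
  ext a
  exact (MonoidalClosed.curry_natural_left _ _).symm

/-- An object with a dual is rigid. -/
lemma IsRigidObject.of_exactPairing (d x : C) [ExactPairing d x] : IsRigidObject x := fun y => by
  have h₁ := isIso_curry_evaluation d x (𝟙_ C)
  have h₂ := isIso_curry_evaluation d x y
  have e₁ : MonoidalClosed.curry (ExactPairing.evaluation d x) = (ρ_ d).inv ≫
      MonoidalClosed.curry ((α_ x d _).inv ≫ ExactPairing.evaluation d x ▷ _ ≫ (λ_ _).hom) := by
    rw [← MonoidalClosed.curry_natural_left]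
    congr 1
    rw [unitors_equal, rightUnitor_naturality]
    simp
  have : IsIso (MonoidalClosed.curry (ExactPairing.evaluation d x)) := by
    rw [e₁]
    infer_instance
  have e₂ : MonoidalClosed.curry (ExactPairing.evaluation d x) ▷ y ≫ dualTensorMap x y =
      MonoidalClosed.curry ((α_ x d y).inv ≫ ExactPairing.evaluation d x ▷ y ≫ (λ_ y).hom) := by
    rw [dualTensorMap, ← MonoidalClosed.curry_natural_left]
    congr 1
    rw [associator_inv_naturality_middle_assoc, ← comp_whiskerRight_assoc,
      MonoidalClosed.whiskerLeft_curry_ihom_ev_app]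
  rw [← e₂] at h₂
  exact IsIso.of_isIso_comp_left (MonoidalClosed.curry (ExactPairing.evaluation d x) ▷ y) _

/-- A rigid object has the dual `hom(x, 𝟙)`. -/
@[reducible]
noncomputable def IsRigidObject.exactPairing {x : C} (hx : IsRigidObject x) :
    ExactPairing ((ihom x).obj (𝟙_ C)) x :=
  have := hx x
  have h : x ◁ (MonoidalClosed.curry (ρ_ x).hom ≫ inv (dualTensorMap x x)) ≫ (α_ _ _ _).inv ≫
      (ihom.ev x).app (𝟙_ C) ▷ x ≫ (λ_ x).hom = (ρ_ x).hom := by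
    apply MonoidalClosed.curry_injective
    rw [MonoidalClosed.curry_natural_left]
    change _ ≫ dualTensorMap x x = _
    simp
  { coevaluation' := MonoidalClosed.curry (ρ_ x).hom ≫ inv (dualTensorMap x x)
    evaluation' := (ihom.ev x).app (𝟙_ C)
    coevaluation_evaluation' := by
      rw [← cancel_mono (λ_ x).hom]
      simpa using h
    evaluation_coevaluation' := by
      have := hx (𝟙_ C)
      -- `dualTensorMap x (𝟙_ C)` is the transpose of pairing with the evaluation, so its
      -- invertibility lets the second triangle identity be checked after that pairing.
      rw [← cancel_mono (dualTensorMap x (𝟙_ C))]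
      apply MonoidalClosed.uncurry_injective
      rw [MonoidalClosed.uncurry_natural_left, MonoidalClosed.uncurry_natural_left]
      simp only [dualTensorMap, MonoidalClosed.uncurry_curry]
      exact triangle_of_triangle _ _ h }

end Closed

open Functor.LaxMonoidal Functor.OplaxMonoidal in
lemma whiskerLeft_δ_comp_μ_whiskerRight {D : Type u₁} [Category.{v} D] [MonoidalCategory D]
    (F : D ⥤ C) [F.Monoidal] (x y z : D) :
    F.obj x ◁ δ F y z ≫ (α_ _ _ _).inv ≫ μ F x y ▷ F.obj z =
      μ F x (y ⊗ z) ≫ F.map (α_ _ _ _).inv ≫ δ F (x ⊗ y) z := by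
  rw [Functor.Monoidal.map_associator_inv]
  simp only [Category.assoc, Functor.Monoidal.μ_δ_assoc, Functor.Monoidal.μ_δ, Category.comp_id]

open Functor.LaxMonoidal Functor.OplaxMonoidal in
lemma δ_whiskerRight_comp_whiskerLeft_μ {D : Type u₁} [Category.{v} D] [MonoidalCategory D]
    (F : D ⥤ C) [F.Monoidal] (x y z : D) :
    δ F x y ▷ F.obj z ≫ (α_ _ _ _).hom ≫ F.obj x ◁ μ F y z =
      μ F (x ⊗ y) z ≫ F.map (α_ _ _ _).hom ≫ δ F x (y ⊗ z) := by
  rw [Functor.Monoidal.map_associator]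
  simp only [Category.assoc, Functor.Monoidal.μ_δ_assoc, Functor.Monoidal.μ_δ, Category.comp_id]

open Functor.LaxMonoidal Functor.OplaxMonoidal in
/-- A monoidal functor preserves duals. -/
@[reducible]
def exactPairingMap {D : Type u₁} [Category.{v} D] [MonoidalCategory D] (F : D ⥤ C) [F.Monoidal]
    (x y : D) [ExactPairing x y] : ExactPairing (F.obj x) (F.obj y) where
  coevaluation' := ε F ≫ F.map (ExactPairing.coevaluation x y) ≫ δ F _ _
  evaluation' := μ F _ _ ≫ F.map (ExactPairing.evaluation x y) ≫ η F
  coevaluation_evaluation' := by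
    have h := congr_arg F.map (ExactPairing.coevaluation_evaluation x y)
    simp only [F.map_comp] at h
    simp only [MonoidalCategory.whiskerLeft_comp, comp_whiskerRight, Category.assoc]
    rw [reassoc_of% whiskerLeft_δ_comp_μ_whiskerRight F y x y, δ_natural_left_assoc,
      μ_natural_right_assoc, reassoc_of% h]
    simp
  evaluation_coevaluation' := by
    have h := congr_arg F.map (ExactPairing.evaluation_coevaluation x y)
    simp only [F.map_comp] at h
    simp only [MonoidalCategory.whiskerLeft_comp, comp_whiskerRight, Category.assoc]
    rw [reassoc_of% δ_whiskerRight_comp_whiskerLeft_μ F x y x, δ_natural_right_assoc,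
      μ_natural_left_assoc, reassoc_of% h]
    simp

/-- `F` need not commute with internal homs, so the argument passes through dual pairs, which are
defined by equations alone. -/
lemma IsRigidObject.map {D : Type u₁} [Category.{v} D] [MonoidalCategory D] [MonoidalClosed D]
    [MonoidalClosed C] (F : D ⥤ C) [F.Monoidal] {x : D} (hx : IsRigidObject x) :
    IsRigidObject (F.obj x) :=
  have := hx.exactPairing
  have := exactPairingMap F ((ihom x).obj (𝟙_ D)) x
  .of_exactPairing (F.obj ((ihom x).obj (𝟙_ D))) _

open Functor.LaxMonoidal Functor.OplaxMonoidal in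
/-- The projection formula for an object with a dual. -/
lemma isIso_projMap_of_exactPairing {D : Type u₁} [Category.{v} D] [MonoidalCategory D]
    {F : D ⥤ C} [F.Monoidal] {R : C ⥤ D} (adj : F ⊣ R) (x d : D) [ExactPairing x d] (y : C) :
    IsIso (projMap adj x y) := by
  let := exactPairingMap F x d
  refine isIso_of_yoneda_map_bijective _ fun z => ?_
  -- Read from the last factor: Hom(z, x ⊗ R y) ≅ Hom(d ⊗ z, R y) ≅ Hom(F(d ⊗ z), y) ≅ Hom(F d ⊗ F
  -- z, y) ≅ Hom(F z, F x ⊗ y) ≅ Hom(z, R(F x ⊗ y)). The rest checks that the composite is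
  -- composition with `projMap`.
  have h := (adj.homEquiv z _).bijective.comp <|
    (tensorLeftHomEquiv (F.obj z) (F.obj x) (F.obj d) y).bijective.comp <|
    ((Functor.Monoidal.μIso F d z).symm.homCongr (Iso.refl y)).bijective.comp <|
    (adj.homEquiv (d ⊗ z) y).symm.bijective.comp
    (tensorLeftHomEquiv z x d (R.obj y)).symm.bijective
  convert h using 1
  ext a
  simp only [Function.comp_apply]
  rw [projMap, ← adj.homEquiv_naturality_left, EmbeddingLike.apply_eq_iff_eq, ← Equiv.symm_apply_eq]
  simp [tensorLeftHomEquiv, Adjunction.homEquiv_counit]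
  change _ ≫ _ ≫ _ ≫ _ ≫ (μ F d x ≫ F.map (ExactPairing.evaluation x d) ≫ η F) ▷ _ ≫ _ = _
  rw [← μ_natural_right_assoc, associator_inv_naturality_right_assoc, whisker_exchange_assoc,
    leftUnitor_naturality]
  simp only [comp_whiskerRight, Category.assoc]
  rw [reassoc_of% whiskerLeft_δ_comp_μ_whiskerRight F d x (R.obj y), δ_natural_left_assoc]
  simp

end Duals

/-! ### Transformations of triangulated functors -/

section Transformations

open Pretriangulated

variable {D : Type u₁} [Category.{v} D] [HasZeroObject D] [Preadditive D] [HasShift D ℤ]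
    [∀ n : ℤ, (shiftFunctor D n).Additive] [Pretriangulated D]
    {C : Type u₂} [Category.{v} C] [HasZeroObject C] [Preadditive C] [HasShift C ℤ]
    [∀ n : ℤ, (shiftFunctor C n).Additive] [Pretriangulated C]
    {A B : D ⥤ C} [A.CommShift ℤ] [A.IsTriangulated] [B.CommShift ℤ] [B.IsTriangulated]

variable (A) in
lemma exact_rightComp_map (z : C) (T : Triangle D) (hT : T ∈ distTriang D) :
    Function.Exact (Preadditive.rightComp z (A.map T.mor₁))
      (Preadditive.rightComp z (A.map T.mor₂)) := by
  intro a
  constructor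
  · intro h
    obtain ⟨b, hb⟩ := Triangle.coyoneda_exact₂ _ (A.map_distinguished T hT) a h
    exact ⟨b, hb.symm⟩
  · rintro ⟨b, rfl⟩
    change (b ≫ A.map T.mor₁) ≫ A.map T.mor₂ = 0
    rw [Category.assoc, ← A.map_comp, comp_distTriang_mor_zero₁₂ _ hT, A.map_zero, comp_zero]

/-- The five lemma for a natural transformation between triangulated functors which need not
commute with the shift. -/
lemma isIso_app_obj₃ (τ : A ⟶ B) (T : Triangle D) (hT : T ∈ distTriang D)
    (h₁ : IsIso (τ.app T.obj₁)) (h₂ : IsIso (τ.app T.obj₂)) (h₁' : IsIso (τ.app (T.obj₁⟦(1 : ℤ)⟧)))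
    (h₂' : IsIso (τ.app (T.obj₂⟦(1 : ℤ)⟧))) : IsIso (τ.app T.obj₃) := by
  refine isIso_of_yoneda_map_bijective _ fun z => ?_
  -- Rotating in `D` before applying `A` and `B` keeps the shifts inside the functors, so naturality
  -- of `τ` alone makes the squares commute.
  have hT₁ := rot_of_distTriang _ hT
  have hT₂ := rot_of_distTriang _ hT₁
  have bij {x : D} (h : IsIso (τ.app x)) :
      Function.Bijective (Preadditive.rightComp z (τ.app x)) :=
    ⟨fun _ _ h => (cancel_mono (τ.app x)).1 h, fun b => ⟨b ≫ inv (τ.app x), by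
      change (_ ≫ _) ≫ _ = _
      simp⟩⟩
  have comm {x y : D} (f : x ⟶ y) : (Preadditive.rightComp z (B.map f)).comp
      (Preadditive.rightComp z (τ.app x)) =
      (Preadditive.rightComp z (τ.app y)).comp (Preadditive.rightComp z (A.map f)) := by
    ext (a : z ⟶ A.obj x)
    change (a ≫ _) ≫ _ = (a ≫ _) ≫ _
    simp
  exact AddMonoidHom.bijective_of_surjective_of_bijective_of_bijective_of_injective
    (Preadditive.rightComp z (A.map T.mor₁)) (Preadditive.rightComp z (A.map T.mor₂))
    (Preadditive.rightComp z (A.map T.mor₃)) (Preadditive.rightComp z (A.map T.rotate.mor₃))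
    (Preadditive.rightComp z (B.map T.mor₁)) (Preadditive.rightComp z (B.map T.mor₂))
    (Preadditive.rightComp z (B.map T.mor₃)) (Preadditive.rightComp z (B.map T.rotate.mor₃))
    (Preadditive.rightComp z (τ.app _)) (Preadditive.rightComp z (τ.app _))
    (Preadditive.rightComp z (τ.app _)) (Preadditive.rightComp z (τ.app _))
    (Preadditive.rightComp z (τ.app _)) (comm _) (comm _) (comm _) (comm _)
    (exact_rightComp_map A z T hT) (exact_rightComp_map A z _ hT₁) (exact_rightComp_map A z _ hT₂)
    (exact_rightComp_map B z T hT) (exact_rightComp_map B z _ hT₁) (exact_rightComp_map B z _ hT₂)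
    (bij h₁).2 (bij h₂) (bij h₁') (bij h₂').1

lemma isIso_app_sigma {A B : D ⥤ C} (τ : A ⟶ B) {J : Type v} (X : J → D) [HasCoproduct X]
    [PreservesColimit (Discrete.functor X) A] [PreservesColimit (Discrete.functor X) B]
    (h : ∀ j, IsIso (τ.app (X j))) : IsIso (τ.app (∐ X)) := by
  obtain ⟨σ, hσ⟩ := exists_desc_map_sigma B X (fun j => inv (τ.app (X j)) ≫ A.map (Sigma.ι X j))
  refine ⟨σ, map_sigma_hom_ext A fun j => ?_, map_sigma_hom_ext B fun j => ?_⟩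
  · rw [τ.naturality_assoc, hσ]
    simp
  · rw [reassoc_of% hσ j, τ.naturality]
    simp

/-- The objects at all of whose shifts a transformation of triangulated functors is invertible. -/
lemma isLocalizing_isIso_app (τ : A ⟶ B)
    (hA : ∀ J : Type v, PreservesColimitsOfShape (Discrete J) A)
    (hB : ∀ J : Type v, PreservesColimitsOfShape (Discrete J) B) :
    IsLocalizing fun x : D => ∀ n : ℤ, IsIso (τ.app (x⟦n⟧)) where
  of_iso e h n := (NatTrans.isIso_app_iff_of_iso τ ((shiftFunctor D n).mapIso e)).1 (h n)
  sigma {J} X _ h n := by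
    have := hA J
    have := hB J
    exact isIso_app_sigma (Functor.whiskerLeft (shiftFunctor D n) τ) X fun j => h j n
  -- The five lemma at level `n` also needs level `n + 1`, which is why the property ranges over all
  -- shifts.
  cone T hT h₁ h₂ n :=
    isIso_app_obj₃ τ _ (Triangle.shift_distinguished T hT n) (h₁ n) (h₂ n)
      ((NatTrans.isIso_app_iff_of_iso τ ((shiftFunctorAdd D n 1).app _)).1 (h₁ (n + 1)))
      ((NatTrans.isIso_app_iff_of_iso τ ((shiftFunctorAdd D n 1).app _)).1 (h₂ (n + 1)))

/-- A transformation between triangulated functors which preserve coproducts is invertible as soon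
as it is so at the generators. -/
lemma isIso_app_of_generators [HasCoproducts.{v} D] {G : Set D} [Small.{v} G]
    (hG : IsCompactGeneratingSet G) (τ : A ⟶ B)
    (hA : ∀ J : Type v, PreservesColimitsOfShape (Discrete J) A)
    (hB : ∀ J : Type v, PreservesColimitsOfShape (Discrete J) B)
    (h : ∀ g ∈ G, IsIso (τ.app g)) (x : D) : IsIso (τ.app x) := by
  refine (NatTrans.isIso_app_iff_of_iso τ ((shiftFunctorZero D ℤ).app x)).1
    ((isLocalizing_isIso_app τ hA hB).of_generators hG (fun g hg n => ?_) x 0)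
  obtain ⟨g', hg', ⟨e⟩⟩ := hG.shift g hg n
  exact (NatTrans.isIso_app_iff_of_iso τ e).2 (h g' hg')

end Transformations

/-! ### Existence of the adjoints and the projection formula -/

section ProjectionFormula

variable {D : Type u₁} [Category.{v} D] [HasZeroObject D] [Preadditive D] [HasShift D ℤ]
    [∀ n : ℤ, (shiftFunctor D n).Additive] [Pretriangulated D]
    [MonoidalCategory D] [SymmetricCategory D] [MonoidalClosed D]
    [IsRigidlyCompactlyGenerated D]
    {C : Type u₂} [Category.{v} C] [HasZeroObject C] [Preadditive C] [HasShift C ℤ]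
    [∀ n : ℤ, (shiftFunctor C n).Additive] [Pretriangulated C]
    [MonoidalCategory C] [SymmetricCategory C] [MonoidalClosed C]
    [IsRigidlyCompactlyGenerated C]
    {F : D ⥤ C} [F.Monoidal]

variable (F) in
lemma isCompactObject_map {x : D} (hx : IsCompactObject x) : IsCompactObject (F.obj x) :=
  (IsRigidlyCompactlyGenerated.compact_iff_rigid _).2
    (((IsRigidlyCompactlyGenerated.compact_iff_rigid _).1 hx).map F)

variable [F.CommShift ℤ] [F.IsTriangulated]

variable {R : C ⥤ D} (adj : F ⊣ R)

include adj in
lemma preservesCoproducts_of_adjunction (J : Type v) : PreservesColimitsOfShape (Discrete J) R := by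
  obtain ⟨G, _, hG⟩ := exists_isCompactGeneratingSet (D := D)
  have := IsCompactlyGenerated.hasCoproducts (T := C)
  have := IsCompactlyGenerated.hasCoproducts (T := D)
  exact preservesCoproducts_rightAdjoint hG adj (fun _ => isCompactObject_map F) J

variable (F) in
lemma exists_adjoints (hF : ∀ J : Type v, PreservesColimitsOfShape (Discrete J) F) :
    ∃ (R : C ⥤ D) (S : D ⥤ C), Nonempty (F ⊣ R) ∧ Nonempty (R ⊣ S) := by
  obtain ⟨G, _, hG⟩ := exists_isCompactGeneratingSet (D := D)
  obtain ⟨G', _, hG'⟩ := exists_isCompactGeneratingSet (D := C)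
  have := IsCompactlyGenerated.hasCoproducts (T := C)
  have := IsCompactlyGenerated.hasCoproducts (T := D)
  have := isLeftAdjoint_of_preservesCoproducts F hG hF
  let adj := Adjunction.ofIsLeftAdjoint F
  let := adj.rightAdjointCommShift ℤ
  have := adj.commShift_of_leftAdjoint ℤ
  have := adj.isTriangulated_rightAdjoint
  have := isLeftAdjoint_of_preservesCoproducts F.rightAdjoint hG'
    (preservesCoproducts_of_adjunction adj)
  exact ⟨_, _, ⟨adj⟩, ⟨Adjunction.ofIsLeftAdjoint F.rightAdjoint⟩⟩

/-- The projection formula. -/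
lemma isIso_projMap (hF : ∀ J : Type v, PreservesColimitsOfShape (Discrete J) F) (x : D) (y : C) :
    IsIso (projMap adj x y) := by
  obtain ⟨G, _, hG⟩ := exists_isCompactGeneratingSet (D := D)
  have := IsCompactlyGenerated.hasCoproducts (T := D)
  let := adj.rightAdjointCommShift ℤ
  have := adj.commShift_of_leftAdjoint ℤ
  have := adj.isTriangulated_rightAdjoint
  have hR := preservesCoproducts_of_adjunction adj
  obtain ⟨_, _⟩ := IsTensorTriangulated.exact_tensorLeft (R.obj y)
  obtain ⟨_, _⟩ := IsTensorTriangulated.exact_tensorLeft y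
  -- `projFixRight` differs from `projMap` only by symmetries.
  have key (x : D) : IsIso ((projFixRight adj y).app x) ↔ IsIso (projMap adj x y) := by
    dsimp [projFixRight]
    rw [isIso_comp_left_iff, isIso_comp_right_iff]
  rw [← key]
  refine isIso_app_of_generators hG (projFixRight adj y) (fun _ => inferInstance)
    (fun J => ?_) (fun g hg => (key g).2 ?_) x
  · have := hF J
    have := hR J
    infer_instance
  · have hg' := (IsRigidlyCompactlyGenerated.compact_iff_rigid g).1 (hG.compact g hg)
    let := hg'.exactPairing
    -- Rigidity provides a dual on one side; the braiding moves it to the side needed here.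
    let := BraidedCategory.exactPairing_swap ((ihom g).obj (𝟙_ D)) g
    exact isIso_projMap_of_exactPairing adj g ((ihom g).obj (𝟙_ D)) y

end ProjectionFormula

/-! ### Internal hom formulas by conjugation -/

section Conjugates

variable {D : Type u₁} [Category.{v} D] [MonoidalCategory D]
    {C : Type u₂} [Category.{v} C] [MonoidalCategory C] {F : D ⥤ C} [F.Monoidal] {R : C ⥤ D}
    {S : D ⥤ C} (adj : F ⊣ R) (adj' : R ⊣ S)

/-- The projection formula as an isomorphism natural in both variables. -/
noncomputable def projIso (h : ∀ x y, IsIso (projMap adj x y)) :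
    curriedTensor D ⋙ (Functor.whiskeringLeft C D D).obj R ≅
      F ⋙ curriedTensor C ⋙ (Functor.whiskeringRight C C D).obj R :=
  NatIso.ofComponents
    (fun x => NatIso.ofComponents (fun y => asIso (projMap adj x y))
      (fun g => projMap_natural_right adj x g))
    (fun f => by
      ext y
      exact projMap_natural_left adj f y)

lemma projFixRight_natural [SymmetricCategory D] [SymmetricCategory C] {x x' : C} (f : x ⟶ x') :
    projFixRight adj x ≫ Functor.whiskerLeft F (Functor.whiskerRight ((tensoringLeft C).map f) R) =
      (tensoringLeft D).map (R.map f) ≫ projFixRight adj x' := by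
  ext z
  dsimp [projFixRight]
  rw [Category.assoc, Category.assoc, ← R.map_comp, ← BraidedCategory.braiding_naturality_right,
    R.map_comp, ← reassoc_of% projMap_natural_right adj z f,
    BraidedCategory.braiding_naturality_left_assoc]

variable [MonoidalClosed D] [MonoidalClosed C]

/-- Conjugation is compatible with composition and whiskering, so the square is the conjugate of the
naturality square of the monoidal structure of `F`. -/
lemma ihomRightAdjMap_natural {x x' : D} (f : x ⟶ x') :
    Functor.whiskerLeft R (MonoidalClosed.pre f) ≫ ihomRightAdjMap adj x =
      ihomRightAdjMap adj x' ≫ Functor.whiskerRight (MonoidalClosed.pre (F.map f)) R := by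
  unfold ihomRightAdjMap MonoidalClosed.pre
  rw [← conjugateEquiv_whiskerRight, ← conjugateEquiv_whiskerLeft, conjugateEquiv_comp,
    conjugateEquiv_comp]
  congr 1
  ext z
  simp

lemma isIso_ihomRightAdjMap (x : D) : IsIso (ihomRightAdjMap adj x) := by
  unfold ihomRightAdjMap
  infer_instance

/-- The isomorphism `hom(x, R y) ≅ R hom(F x, y)`, natural in both variables. -/
noncomputable def ihomRightAdjIso :
    MonoidalClosed.internalHom ⋙ (Functor.whiskeringLeft C D D).obj R ≅
      F.op ⋙ MonoidalClosed.internalHom ⋙ (Functor.whiskeringRight C C D).obj R :=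
  NatIso.ofComponents
    (fun x => @asIso _ _ _ _ _ (isIso_ihomRightAdjMap adj x.unop))
    (fun f => ihomRightAdjMap_natural adj f.unop)

lemma coprojMap_natural {x x' : D} (f : x ⟶ x') :
    Functor.whiskerLeft S (MonoidalClosed.pre (F.map f)) ≫ coprojMap adj adj' x =
      coprojMap adj adj' x' ≫ Functor.whiskerRight (MonoidalClosed.pre f) S := by
  unfold coprojMap MonoidalClosed.pre
  rw [← conjugateEquiv_whiskerRight, ← conjugateEquiv_whiskerLeft, conjugateEquiv_comp,
    conjugateEquiv_comp]
  congr 1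
  ext z
  exact (projMap_natural_left adj f z).symm

lemma isIso_coprojMap (h : ∀ x y, IsIso (projMap adj x y)) (x : D) :
    IsIso (coprojMap adj adj' x) := by
  have (y : C) : IsIso ((projFixLeft adj x).app y) := h x y
  have := NatIso.isIso_of_isIso_app (projFixLeft adj x)
  unfold coprojMap
  infer_instance

/-- The isomorphism `S hom(x, y) ≅ hom(F x, S y)`, natural in both variables. -/
noncomputable def coprojIso (h : ∀ x y, IsIso (projMap adj x y)) :
    MonoidalClosed.internalHom ⋙ (Functor.whiskeringRight D D C).obj S ≅
      F.op ⋙ MonoidalClosed.internalHom ⋙ (Functor.whiskeringLeft D C C).obj S :=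
  (NatIso.ofComponents
    (fun x => @asIso _ _ _ _ _ (isIso_coprojMap adj adj' h x.unop))
    (fun f => coprojMap_natural adj adj' f.unop)).symm

variable [SymmetricCategory D] [SymmetricCategory C]

lemma ihomLeftAdjMap_natural {x x' : C} (f : x ⟶ x') :
    Functor.whiskerLeft S (Functor.whiskerRight (MonoidalClosed.pre f) R) ≫
        ihomLeftAdjMap adj adj' x =
      ihomLeftAdjMap adj adj' x' ≫ MonoidalClosed.pre (R.map f) := by
  unfold ihomLeftAdjMap MonoidalClosed.pre
  -- Here `pre f` sits between `S` and `R`, so conjugation is passed through whiskering once for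
  -- each adjunction.
  have h := conjugateEquiv_whiskerLeft ((ihom.adjunction x').comp adj')
    ((ihom.adjunction x).comp adj') adj (Functor.whiskerRight ((tensoringLeft C).map f) R)
  rw [conjugateEquiv_whiskerRight (ihom.adjunction x') (ihom.adjunction x) adj'] at h
  refine (congrArg (· ≫ _) h.symm).trans ?_
  rw [conjugateEquiv_comp, conjugateEquiv_comp, projFixRight_natural]

lemma isIso_ihomLeftAdjMap (h : ∀ x y, IsIso (projMap adj x y)) (x : C) :
    IsIso (ihomLeftAdjMap adj adj' x) := by
  have (y : D) : IsIso ((projFixRight adj x).app y) := by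
    dsimp [projFixRight]
    infer_instance
  have := NatIso.isIso_of_isIso_app (projFixRight adj x)
  unfold ihomLeftAdjMap
  infer_instance

/-- The isomorphism `hom(R x, y) ≅ R hom(x, S y)`, natural in both variables. -/
noncomputable def ihomLeftAdjIso (h : ∀ x y, IsIso (projMap adj x y)) :
    R.op ⋙ MonoidalClosed.internalHom ≅
      MonoidalClosed.internalHom ⋙ (Functor.whiskeringLeft D C C).obj S ⋙
        (Functor.whiskeringRight D C D).obj R :=
  (NatIso.ofComponents
    (fun x => @asIso _ _ _ _ _ (isIso_ihomLeftAdjMap adj adj' h x.unop))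
    (fun f => ihomLeftAdjMap_natural adj adj' f.unop)).symm

end Conjugates

end RigidTT

theorem mainTheorem12
    {D : Type u₁} [Category.{v} D] [HasZeroObject D] [Preadditive D] [HasShift D ℤ]
    [∀ n : ℤ, (shiftFunctor D n).Additive] [Pretriangulated D] [IsTriangulated D]
    [MonoidalCategory D] [SymmetricCategory D] [MonoidalClosed D]
    [RigidTT.IsRigidlyCompactlyGenerated D]
    {C : Type u₂} [Category.{v} C] [HasZeroObject C] [Preadditive C] [HasShift C ℤ]
    [∀ n : ℤ, (shiftFunctor C n).Additive] [Pretriangulated C] [IsTriangulated C]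
    [MonoidalCategory C] [SymmetricCategory C] [MonoidalClosed C]
    [RigidTT.IsRigidlyCompactlyGenerated C]
    (F : D ⥤ C) [F.Braided] [F.CommShift ℤ] [F.IsTriangulated]
    (hF : ∀ J : Type v, PreservesColimitsOfShape (Discrete J) F) :
    -- `F = f^*` preserves compact objects
    (∀ x : D, RigidTT.IsCompactObject x → RigidTT.IsCompactObject (F.obj x)) ∧
    -- existence of `R = f_*` and `S = f^{(1)}` with `F ⊣ R ⊣ S`
    (∃ (R : C ⥤ D) (S : D ⥤ C), Nonempty (F ⊣ R) ∧ Nonempty (R ⊣ S)) ∧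
    -- the four formulas, for all choices of the adjoints
    (∀ (R : C ⥤ D) (S : D ⥤ C) (adj : F ⊣ R) (adj' : R ⊣ S),
      -- `x ⊗ R y ≅ R (F x ⊗ y)`
      (∃ π : curriedTensor D ⋙ (Functor.whiskeringLeft C D D).obj R ≅
          F ⋙ curriedTensor C ⋙ (Functor.whiskeringRight C C D).obj R,
        ∀ (x : D) (y : C), (π.hom.app x).app y = RigidTT.projMap adj x y) ∧
      -- `hom(x, R y) ≅ R hom(F x, y)`
      (∃ θ : MonoidalClosed.internalHom ⋙ (Functor.whiskeringLeft C D D).obj R ≅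
          F.op ⋙ MonoidalClosed.internalHom ⋙ (Functor.whiskeringRight C C D).obj R,
        ∀ (x : D) (y : C),
          (θ.hom.app (op x)).app y = (RigidTT.ihomRightAdjMap adj x).app y) ∧
      -- `hom(R x, y) ≅ R hom(x, S y)`
      (∃ θ : R.op ⋙ MonoidalClosed.internalHom ≅
          MonoidalClosed.internalHom ⋙ (Functor.whiskeringLeft D C C).obj S ⋙
            (Functor.whiskeringRight D C D).obj R,
        ∀ (x : C) (y : D),
          (θ.inv.app (op x)).app y = (RigidTT.ihomLeftAdjMap adj adj' x).app y) ∧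
      -- `S hom(x, y) ≅ hom(F x, S y)`
      (∃ θ : MonoidalClosed.internalHom ⋙ (Functor.whiskeringRight D D C).obj S ≅
          F.op ⋙ MonoidalClosed.internalHom ⋙ (Functor.whiskeringLeft D C C).obj S,
        ∀ x y : D,
          (θ.inv.app (op x)).app y = (RigidTT.coprojMap adj adj' x).app y)) := by
  have hproj {R : C ⥤ D} (adj : F ⊣ R) (x : D) (y : C) : IsIso (RigidTT.projMap adj x y) :=
    RigidTT.isIso_projMap adj hF x y
  refine ⟨fun x hx => RigidTT.isCompactObject_map F hx, RigidTT.exists_adjoints F hF,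
    fun R S adj adj' => ⟨⟨RigidTT.projIso adj (hproj adj), fun _ _ => rfl⟩,
      ⟨RigidTT.ihomRightAdjIso adj, fun _ _ => rfl⟩,
      ⟨RigidTT.ihomLeftAdjIso adj adj' (hproj adj), fun _ _ => rfl⟩,
      ⟨RigidTT.coprojIso adj adj' (hproj adj), fun _ _ => rfl⟩⟩⟩
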